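/- Work over $\mathbb{C}$. For a homogeneous polynomial $f \in \mathbb{C}[x_0,\dots,x_n]$ of degree $d \ge 1$, the Waring rank $\mathrm{R}(f)$ is the least $r$ such that $f = \ell_1^d + \cdots + \ell_r^d$ for some linear forms $\ell_1,\dots,\ell_r$. A minimal decomposition of $f$ is a set $\{[\ell_1],\dots,[\ell_r]\}$ of exactly $r = \mathrm{R}(f)$ points of the projective space of linear forms such that $f$ is a linear combination of $\ell_1^d,\dots,\ell_r^d$. **Proposition 3.1.** Let $k, n \ge 1$ and let $\ell = a_0x_0 + \cdots + a_nx_n$ be a linear form with $a_0 \cdots a_n \ne 0$. For $\lambda \in \mathbb{C}\setminus\{0\}$ set $f_\lambda = (x_0\cdots x_n)^k + \lambda\, \ell^{(n+1)k}$. Then there is a unique $\lambda_0 \in \mathbb{C}\setminus\{0\}$ such that, for all $\lambda \in \mathbb{C}\setminus\{0\}$: * $\mathrm{R}(f_\lambda) = (k+1)^n - 1$ if and only if $\lambda = \lambda_0$; * if $\lambda = \lambda_0$, then $f_\lambda$ has a unique minimal decomposition; * if $\lambda \ne \lambda_0$, then $\mathrm{R}(f_\lambda) = (k+1)^n$. 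-/

import Mathlib

namespace Waring

noncomputable section

open MvPolynomial

/-- The linear form `v₀ x₀ + ⋯ + vₙ xₙ` in `ℂ[x₀, …, xₙ]` with coefficient vector `v`. -/
def linearForm {n : ℕ} (v : Fin (n + 1) → ℂ) : MvPolynomial (Fin (n + 1)) ℂ :=
  ∑ i, C (v i) * X i

/-- The Waring rank of a form `f` of degree `d`: the least `r` such that `f` is a sum of `r`
`d`-th powers of linear forms. (For `d ≥ 1` every complex form of degree `d` is such a sum.) -/
def waringRank {n : ℕ} (d : ℕ) (f : MvPolynomial (Fin (n + 1)) ℂ) : ℕ :=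
  sInf {r : ℕ | ∃ v : Fin r → (Fin (n + 1) → ℂ), f = ∑ j, linearForm (v j) ^ d}

/-- The linear span of the image under the `d`-th Veronese map of a finite set `S` of points of
the projective space of linear forms: the span of all `ℓ ^ d` with `[ℓ] ∈ S`. -/
def veroneseSpan {n : ℕ} (d : ℕ) (S : Finset (Projectivization ℂ (Fin (n + 1) → ℂ))) :
    Submodule ℂ (MvPolynomial (Fin (n + 1)) ℂ) :=
  Submodule.span ℂ
    {q | ∃ (v : Fin (n + 1) → ℂ) (hv : v ≠ 0),
      Projectivization.mk ℂ v hv ∈ S ∧ q = linearForm v ^ d}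

/-- `S` is a Waring decomposition of the form `f` of degree `d`. -/
def IsDecomposition {n : ℕ} (d : ℕ) (f : MvPolynomial (Fin (n + 1)) ℂ)
    (S : Finset (Projectivization ℂ (Fin (n + 1) → ℂ))) : Prop :=
  f ∈ veroneseSpan d S

/-- `S` is a minimal Waring decomposition of the form `f` of degree `d`: its number of points
equals the Waring rank. -/
def IsMinimalDecomposition {n : ℕ} (d : ℕ) (f : MvPolynomial (Fin (n + 1)) ℂ)
    (S : Finset (Projectivization ℂ (Fin (n + 1) → ℂ))) : Prop :=
  IsDecomposition d f S ∧ S.card = waringRank d f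

/-- The form `(x₀ ⋯ xₙ) ^ k + c ℓ ^ ((n + 1) k)`, where `ℓ = a₀ x₀ + ⋯ + aₙ xₙ`. -/
def monomialPlusPower {n : ℕ} (k : ℕ) (a : Fin (n + 1) → ℂ) (c : ℂ) :
    MvPolynomial (Fin (n + 1)) ℂ :=
  (∏ i, X i) ^ k + C c * linearForm a ^ ((n + 1) * k)

end

end Waring

/-! Write `N = (k + 1) ^ n` and `d = (n + 1) k`. In affine coordinates `yᵢ = xᵢ / x₀`, a
decomposition of the monomial `(x₀ ⋯ xₙ) ^ k` is a weighted sum over points that, up to degree `n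
k`, kills every monomial except `(y₁ ⋯ yₙ) ^ k`. Pairing complementary exponents `b` and `k - b`
makes the `N` monomials with exponents at most `k` independent on the points, so at least `N` points
occur (`card_ge_of_moments`). With exactly `N` points they form a basis of the functions there, and
expanding `yⱼ ^ (k + 1)` in it leaves only a constant (`pow_eq_of_moments`). Hence an `N`-point
decomposition through a point with nonzero coordinates is its orbit under `(k + 1)`-st roots of
unity (`eq_rootOrbit`); conversely each such orbit is a decomposition, with all weights nonzero.

Adjoining `[ℓ]` to a decomposition of `f_λ` gives one of the monomial. So `f_λ` needs at least `N -
1` points, and `N - 1` suffice only for the orbit of `[ℓ]` with `[ℓ]` removed, which works for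
exactly one `λ`. -/

open MvPolynomial

namespace Waring

/-! ### Point sets with prescribed moments -/

/-- Let weighted points of affine space have, up to degree `n k`, the moments of a nonzero multiple
of the functional dual to `(y₁ ⋯ yₙ) ^ k`, and let `P` be an upward closed condition on exponents
such that the function `φ` is orthogonal to the monomials complementary to those satisfying `P`.
If `φ` is a combination of the monomials with exponents at most `k`, then only monomials not
satisfying `P` occur in it. -/
theorem coeff_eq_zero_of_moments {n k : ℕ} {ι : Type*} [Fintype ι] {u : ι → Fin n → ℂ}
    {w : ι → ℂ} {κ : ℂ} (hκ : κ ≠ 0)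
    (h : ∀ γ : Fin n → ℕ, ∑ i, γ i ≤ n * k →
      ∑ s, w s * ∏ i, u s i ^ γ i = if γ = fun _ => k then κ else 0)
    (c : (Fin n → Fin (k + 1)) → ℂ) (φ : ι → ℂ) (P : (Fin n → Fin (k + 1)) → Prop)
    (hφ : ∀ b, P b → ∑ s, w s * (φ s * ∏ i, u s i ^ (k - (b i : ℕ))) = 0)
    (hP : ∀ b b', P b → ∑ i, (b i : ℕ) ≤ ∑ i, (b' i : ℕ) → P b')
    (hc : ∀ s, φ s = ∑ b, c b * ∏ i, u s i ^ (b i : ℕ)) (b : Fin n → Fin (k + 1)) (hb : P b) :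
    c b = 0 := by
  by_contra hne
  have hmem : b ∈ Finset.univ.filter (fun b => c b ≠ 0) := by simp [hne]
  -- For a monomial `t` of top degree in `φ`, multiplying by its complement keeps all degrees at
  -- most `n k`, and only `t` itself lands on `(k, …, k)`.
  obtain ⟨t, ht, hmax⟩ := Finset.exists_max_image (Finset.univ.filter (fun b => c b ≠ 0))
    (fun b => ∑ i, (b i : ℕ)) ⟨b, hmem⟩
  have hPt : P t := hP b t hb (hmax b hmem)
  have hlt : ∀ i, (t i : ℕ) ≤ k := fun i => Nat.lt_succ_iff.1 (t i).2
  have hsumt : ∑ i, (k - (t i : ℕ)) + ∑ i, (t i : ℕ) = n * k := by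
    rw [← Finset.sum_add_distrib, Finset.sum_congr rfl (fun i _ => Nat.sub_add_cancel (hlt i))]
    simp
  have key : ∑ s, w s * (φ s * ∏ i, u s i ^ (k - (t i : ℕ))) = c t * κ := by
    have h1 : ∀ s, w s * (φ s * ∏ i, u s i ^ (k - (t i : ℕ))) =
        ∑ b, c b * (w s * ∏ i, u s i ^ ((b i : ℕ) + (k - (t i : ℕ)))) := by
      intro s
      rw [hc s, Finset.sum_mul, Finset.mul_sum]
      refine Finset.sum_congr rfl fun b _ => ?_
      simp only [pow_add, Finset.prod_mul_distrib]
      ring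
    simp only [h1]
    rw [Finset.sum_comm, Finset.sum_eq_single t]
    · rw [← Finset.mul_sum, h]
      · rw [if_pos]
        funext i
        have := hlt i
        omega
      · rw [Finset.sum_add_distrib]
        omega
    · intro b _ hbt
      by_cases hcb : c b = 0
      · simp [hcb]
      have hle : ∑ i, (b i : ℕ) ≤ ∑ i, (t i : ℕ) := hmax b (by simp [hcb])
      rw [← Finset.mul_sum, h, if_neg, mul_zero]
      · intro he
        apply hbt
        funext i
        have h2 := congrFun he i
        have := hlt i
        ext
        omega
      · rw [Finset.sum_add_distrib]
        omega
    · simp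
  rw [hφ t hPt] at key
  have hct : c t ≠ 0 := by simpa using ht
  exact mul_ne_zero hct hκ key.symm

theorem linearIndependent_of_moments {n k : ℕ} {ι : Type*} [Fintype ι] {u : ι → Fin n → ℂ}
    {w : ι → ℂ} {κ : ℂ} (hκ : κ ≠ 0)
    (h : ∀ γ : Fin n → ℕ, ∑ i, γ i ≤ n * k →
      ∑ s, w s * ∏ i, u s i ^ γ i = if γ = fun _ => k then κ else 0) :
    LinearIndependent ℂ
      (fun (b : Fin n → Fin (k + 1)) (s : ι) => ∏ i, u s i ^ (b i : ℕ)) := by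
  rw [Fintype.linearIndependent_iff]
  intro c hc b
  refine coeff_eq_zero_of_moments hκ h c (fun _ => 0) (fun _ => True) (by simp) (by simp) ?_ b
    trivial
  intro s
  have := congrFun hc s
  simpa [Finset.sum_apply] using this.symm

theorem card_ge_of_moments {n k : ℕ} {ι : Type*} [Fintype ι] {u : ι → Fin n → ℂ}
    {w : ι → ℂ} {κ : ℂ} (hκ : κ ≠ 0)
    (h : ∀ γ : Fin n → ℕ, ∑ i, γ i ≤ n * k →
      ∑ s, w s * ∏ i, u s i ^ γ i = if γ = fun _ => k then κ else 0) :
    (k + 1) ^ n ≤ Fintype.card ι := by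
  simpa using (linearIndependent_of_moments hκ h).fintype_card_le_finrank

/-- Moments are needed up to degree `(n + 1) k` here: `yⱼ ^ (k + 1)` is paired with the complements
of all nonconstant monomials. -/
theorem pow_eq_of_moments {n k : ℕ} {ι : Type*} [Fintype ι] {u : ι → Fin n → ℂ}
    {w : ι → ℂ} {κ : ℂ} (hκ : κ ≠ 0)
    (h : ∀ γ : Fin n → ℕ, ∑ i, γ i ≤ (n + 1) * k →
      ∑ s, w s * ∏ i, u s i ^ γ i = if γ = fun _ => k then κ else 0)
    (hcard : Fintype.card ι = (k + 1) ^ n) (j : Fin n) (s t : ι) :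
    u s j ^ (k + 1) = u t j ^ (k + 1) := by
  have h' : ∀ γ : Fin n → ℕ, ∑ i, γ i ≤ n * k →
      ∑ s, w s * ∏ i, u s i ^ γ i = if γ = fun _ => k then κ else 0 :=
    fun γ hγ => h γ (hγ.trans (Nat.mul_le_mul_right _ (Nat.le_succ _)))
  have hli := linearIndependent_of_moments hκ h'
  have hspan := hli.span_eq_top_of_card_eq_finrank' (by simp [hcard])
  have hmem : (fun s => u s j ^ (k + 1)) ∈ Submodule.span ℂ (Set.range
      (fun (b : Fin n → Fin (k + 1)) (s : ι) => ∏ i, u s i ^ (b i : ℕ))) := by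
    rw [hspan]; trivial
  obtain ⟨c, hc⟩ := (Submodule.mem_span_range_iff_exists_fun ℂ).1 hmem
  have hc' : ∀ s, u s j ^ (k + 1) = ∑ b, c b * ∏ i, u s i ^ (b i : ℕ) := by
    intro s
    simpa [Finset.sum_apply] using (congrFun hc s).symm
  have hz : ∀ b : Fin n → Fin (k + 1), b ≠ 0 → c b = 0 := by
    intro b hb
    refine coeff_eq_zero_of_moments hκ h' c _ (fun b => 1 ≤ ∑ i, (b i : ℕ)) ?_
      (fun b b' h1 h2 => h1.trans h2) hc' b ?_
    · intro b hb
      have hsum : ∑ i, (k - (b i : ℕ)) + ∑ i, (b i : ℕ) = n * k := by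
        rw [← Finset.sum_add_distrib,
          Finset.sum_congr rfl (fun i _ => Nat.sub_add_cancel (Nat.lt_succ_iff.1 (b i).2))]
        simp
      -- The total degree is `n k - |b| + k + 1`, within the bound exactly because `|b| ≥ 1`; the
      -- `j`-th exponent exceeds `k`, so this moment vanishes.
      have := h (fun i => (k - (b i : ℕ)) + if i = j then k + 1 else 0) (by
        rw [Finset.sum_add_distrib, Finset.sum_ite_eq' _ _ _, if_pos (Finset.mem_univ _), add_mul]
        omega)
      rw [if_neg (fun he => by have := congrFun he j; simp at this; omega)] at this
      rw [← this]
      refine Finset.sum_congr rfl fun s _ => ?_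
      simp only [pow_add, Finset.prod_mul_distrib]
      simp only [pow_ite, pow_zero, Finset.prod_ite_eq', Finset.mem_univ, if_true, pow_succ]
      ring
    · by_contra hlt
      apply hb
      have h0 : ∑ i, (b i : ℕ) = 0 := by omega
      funext i
      ext
      simpa using (Finset.sum_eq_zero_iff.1 h0) i (Finset.mem_univ _)
  have hconst : ∀ s, u s j ^ (k + 1) = c 0 := by
    intro s
    rw [hc' s, Finset.sum_eq_single 0 (fun b _ hb => by rw [hz b hb, zero_mul]) (by simp)]
    simp
  rw [hconst s, hconst t]

/-! ### Coefficients of powers of linear forms -/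

theorem linearForm_pow {n : ℕ} (v : Fin (n + 1) → ℂ) (d : ℕ) :
    linearForm v ^ d = ∑ γ ∈ Finset.piAntidiag Finset.univ d,
      monomial (Finsupp.equivFunOnFinite.symm γ)
        ((Nat.multinomial Finset.univ γ : ℂ) * ∏ i, v i ^ γ i) := by
  rw [linearForm, Finset.sum_pow_eq_sum_piAntidiag]
  refine Finset.sum_congr rfl fun γ _ => ?_
  rw [monomial_eq, Finsupp.prod_fintype _ _ (by simp)]
  simp only [mul_pow, Finset.prod_mul_distrib, map_mul, map_prod, map_pow, map_natCast]
  simp [mul_assoc]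

theorem coeff_linearForm_pow {n : ℕ} (v : Fin (n + 1) → ℂ) (d : ℕ) (γ : Fin (n + 1) → ℕ) :
    coeff (Finsupp.equivFunOnFinite.symm γ) (linearForm v ^ d) =
      if ∑ i, γ i = d then (Nat.multinomial Finset.univ γ : ℂ) * ∏ i, v i ^ γ i else 0 := by
  rw [linearForm_pow, coeff_sum]
  simp only [coeff_monomial, EmbeddingLike.apply_eq_iff_eq]
  rw [Finset.sum_ite_eq' ]
  simp

theorem prod_X_pow {n : ℕ} (k : ℕ) :
    (∏ i, X i : MvPolynomial (Fin (n + 1)) ℂ) ^ k =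
      monomial (Finsupp.equivFunOnFinite.symm fun _ => k) 1 := by
  rw [monomial_eq, Finsupp.prod_fintype _ _ (by simp)]
  simp [Finset.prod_pow]

theorem multinomial_ne_zero {n : ℕ} (γ : Fin n → ℕ) :
    (Nat.multinomial Finset.univ γ : ℂ) ≠ 0 :=
  Nat.cast_ne_zero.2 (Nat.multinomial_pos _ _).ne'

/-- A linear combination of powers equals `(x₀ ⋯ xₙ) ^ k` if and only if the weighted points
have the right moments. -/
theorem prod_X_pow_eq_sum_iff {n : ℕ} (k : ℕ) {ι : Type*} (s : Finset ι) (w : ι → ℂ)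
    (v : ι → Fin (n + 1) → ℂ) :
    (∏ i, X i : MvPolynomial (Fin (n + 1)) ℂ) ^ k =
        ∑ j ∈ s, w j • linearForm (v j) ^ ((n + 1) * k) ↔
      ∀ γ : Fin (n + 1) → ℕ, ∑ i, γ i = (n + 1) * k → ∑ j ∈ s, w j * ∏ i, v j i ^ γ i =
        if γ = fun _ => k
          then (Nat.multinomial (Finset.univ : Finset (Fin (n + 1))) fun _ => k : ℂ)⁻¹ else 0 := by
  have hcoeff : ∀ γ : Fin (n + 1) → ℕ, coeff (Finsupp.equivFunOnFinite.symm γ)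
      (∑ j ∈ s, w j • linearForm (v j) ^ ((n + 1) * k)) = if ∑ i, γ i = (n + 1) * k then
        (Nat.multinomial Finset.univ γ : ℂ) * ∑ j ∈ s, w j * ∏ i, v j i ^ γ i else 0 := by
    intro γ
    simp only [coeff_sum, coeff_smul, coeff_linearForm_pow, smul_eq_mul]
    split_ifs
    · rw [Finset.mul_sum]
      exact Finset.sum_congr rfl fun _ _ => by ring
    · simp
  constructor
  · intro h γ hγ
    have h1 := congrArg (coeff (Finsupp.equivFunOnFinite.symm γ)) h
    rw [hcoeff, if_pos hγ, prod_X_pow, coeff_monomial] at h1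
    simp only [EmbeddingLike.apply_eq_iff_eq] at h1
    apply mul_left_cancel₀ (multinomial_ne_zero γ)
    rw [← h1]
    by_cases hk : γ = fun _ => k
    · subst hk
      rw [if_pos rfl, if_pos rfl, mul_inv_cancel₀ (multinomial_ne_zero _)]
    · rw [if_neg hk, if_neg (fun h => hk h.symm), mul_zero]
  · intro h
    ext γ'
    obtain ⟨γ, rfl⟩ := Finsupp.equivFunOnFinite.symm.surjective γ'
    rw [hcoeff, prod_X_pow, coeff_monomial]
    simp only [EmbeddingLike.apply_eq_iff_eq]
    by_cases hk : γ = fun _ => k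
    · subst hk
      rw [if_pos rfl, if_pos (by simp), h _ (by simp), if_pos rfl,
        mul_inv_cancel₀ (multinomial_ne_zero _)]
    · rw [if_neg (fun h => hk h.symm)]
      split_ifs with hd
      · rw [h γ hd, if_neg hk, mul_zero]
      · rfl

/-! ### Veronese spans and Waring rank -/

theorem linearForm_smul {n : ℕ} (c : ℂ) (v : Fin (n + 1) → ℂ) :
    linearForm (c • v) = C c * linearForm v := by
  simp [linearForm, Finset.mul_sum, mul_assoc]

theorem linearForm_smul_pow {n : ℕ} (c : ℂ) (v : Fin (n + 1) → ℂ) (d : ℕ) :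
    linearForm (c • v) ^ d = c ^ d • linearForm v ^ d := by
  rw [linearForm_smul, mul_pow, ← map_pow, C_mul']

theorem linearForm_pow_mem_veroneseSpan {n d : ℕ}
    {S : Finset (Projectivization ℂ (Fin (n + 1) → ℂ))} {v : Fin (n + 1) → ℂ} (hv : v ≠ 0)
    (h : Projectivization.mk ℂ v hv ∈ S) : linearForm v ^ d ∈ veroneseSpan d S :=
  Submodule.subset_span ⟨v, hv, h, rfl⟩

theorem veroneseSpan_mono {n d : ℕ} {S T : Finset (Projectivization ℂ (Fin (n + 1) → ℂ))}
    (h : S ⊆ T) : veroneseSpan d S ≤ veroneseSpan d T :=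
  Submodule.span_mono fun _ ⟨v, hv, hS, hq⟩ => ⟨v, hv, h hS, hq⟩

theorem mem_veroneseSpan_iff {n d : ℕ} {S : Finset (Projectivization ℂ (Fin (n + 1) → ℂ))}
    {f : MvPolynomial (Fin (n + 1)) ℂ} :
    f ∈ veroneseSpan d S ↔
      ∃ w : Projectivization ℂ (Fin (n + 1) → ℂ) → ℂ, f = ∑ P ∈ S, w P • linearForm P.rep ^ d := by
  classical
  constructor
  · intro h
    have hle : veroneseSpan d S ≤
        Submodule.span ℂ ((fun P : Projectivization ℂ (Fin (n + 1) → ℂ) =>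
          linearForm P.rep ^ d) '' S) := by
      refine Submodule.span_le.2 ?_
      rintro _ ⟨v, hv, hS, rfl⟩
      obtain ⟨c, hc⟩ := Projectivization.exists_smul_eq_mk_rep ℂ v hv
      have hvc : v = (c⁻¹ : ℂˣ) • (Projectivization.mk ℂ v hv).rep := by
        rw [← hc, inv_smul_smul]
      rw [hvc, Units.smul_def, linearForm_smul_pow]
      exact Submodule.smul_mem _ _ (Submodule.subset_span ⟨_, hS, rfl⟩)
    obtain ⟨w, hw⟩ := (Submodule.mem_span_image_finset_iff_exists_fun ℂ).1 (hle h)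
    refine ⟨fun P => if hP : P ∈ S then w ⟨P, hP⟩ else 0, ?_⟩
    rw [← hw, ← Finset.sum_coe_sort S]
    exact Finset.sum_congr rfl fun P _ => by simp
  · rintro ⟨w, rfl⟩
    refine Submodule.sum_mem _ fun P hP => Submodule.smul_mem _ _ ?_
    exact linearForm_pow_mem_veroneseSpan P.rep_nonzero (by rwa [P.mk_rep])

/-- A sum of `r` powers lies in the Veronese span of at most `r` points. -/
theorem exists_veroneseSpan_of_sum {n d r : ℕ} (hd : d ≠ 0) (v : Fin r → Fin (n + 1) → ℂ) :
    ∃ S : Finset (Projectivization ℂ (Fin (n + 1) → ℂ)), S.card ≤ r ∧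
      ∑ j, linearForm (v j) ^ d ∈ veroneseSpan d S := by
  classical
  refine ⟨(Finset.univ.filter fun j => v j ≠ 0).attach.image fun j =>
    Projectivization.mk ℂ (v j.1) ((Finset.mem_filter (p := fun j => v j ≠ 0)).1 j.2).2, ?_, ?_⟩
  · refine Finset.card_image_le.trans ?_
    rw [Finset.card_attach]
    exact (Finset.card_filter_le _ _).trans (by simp)
  · refine Submodule.sum_mem _ fun j _ => ?_
    by_cases hj : v j = 0
    · simp [hj, linearForm, zero_pow hd]
    · exact linearForm_pow_mem_veroneseSpan hj
        (Finset.mem_image.2 ⟨⟨j, by simp [hj]⟩, Finset.mem_attach _ _, rfl⟩)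

theorem exists_sum_of_mem_veroneseSpan {n d : ℕ} (hd : d ≠ 0)
    {S : Finset (Projectivization ℂ (Fin (n + 1) → ℂ))} {f : MvPolynomial (Fin (n + 1)) ℂ}
    (hf : f ∈ veroneseSpan d S) :
    ∃ v : Fin S.card → Fin (n + 1) → ℂ, f = ∑ j, linearForm (v j) ^ d := by
  obtain ⟨w, rfl⟩ := mem_veroneseSpan_iff.1 hf
  -- Weights are absorbed into the linear forms through `d`-th roots.
  choose z hz using fun P => IsAlgClosed.exists_pow_nat_eq (w P) (Nat.pos_of_ne_zero hd)
  refine ⟨fun j => z (S.equivFin.symm j) • (S.equivFin.symm j : Projectivization ℂ _).rep, ?_⟩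
  simp only [linearForm_smul_pow, hz]
  rw [← Finset.sum_coe_sort S]
  exact (S.equivFin.symm.sum_comp fun P : S => w P • linearForm P.1.rep ^ d).symm

theorem waringRank_le_card {n d : ℕ} (hd : d ≠ 0)
    {S : Finset (Projectivization ℂ (Fin (n + 1) → ℂ))} {f : MvPolynomial (Fin (n + 1)) ℂ}
    (hf : f ∈ veroneseSpan d S) : waringRank d f ≤ S.card :=
  Nat.sInf_le (exists_sum_of_mem_veroneseSpan hd hf)

/-- A form with a decomposition has one with at most as many points as its Waring rank. -/
theorem exists_card_le_waringRank {n d : ℕ} (hd : d ≠ 0)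
    {S : Finset (Projectivization ℂ (Fin (n + 1) → ℂ))} {f : MvPolynomial (Fin (n + 1)) ℂ}
    (hf : f ∈ veroneseSpan d S) :
    ∃ T : Finset (Projectivization ℂ (Fin (n + 1) → ℂ)), T.card ≤ waringRank d f ∧
      f ∈ veroneseSpan d T := by
  obtain ⟨v, hv⟩ := Nat.sInf_mem (s := {r : ℕ | ∃ v : Fin r → (Fin (n + 1) → ℂ),
    f = ∑ j, linearForm (v j) ^ d}) ⟨_, exists_sum_of_mem_veroneseSpan hd hf⟩
  obtain ⟨T, hT, hmem⟩ := exists_veroneseSpan_of_sum hd v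
  exact ⟨T, hT, hv ▸ hmem⟩

/-! ### Affine chart and root-of-unity orbits -/

theorem cons_one_ne_zero {n : ℕ} (u : Fin n → ℂ) : (Fin.cons 1 u : Fin (n + 1) → ℂ) ≠ 0 :=
  fun h => one_ne_zero (congrFun h 0)

/-- The point `[1 : u₁ : ⋯ : uₙ]` of projective space. -/
noncomputable def affinePoint {n : ℕ} (u : Fin n → ℂ) : Projectivization ℂ (Fin (n + 1) → ℂ) :=
  Projectivization.mk ℂ (Fin.cons 1 u) (cons_one_ne_zero u)

/-- The affine coordinates `xᵢ / x₀` of a point of projective space. -/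
noncomputable def affineCoord {n : ℕ} (P : Projectivization ℂ (Fin (n + 1) → ℂ)) (i : Fin n) : ℂ :=
  P.rep i.succ / P.rep 0

theorem mk_eq_affinePoint {n : ℕ} {v : Fin (n + 1) → ℂ} (hv : v ≠ 0) (h0 : v 0 ≠ 0) :
    Projectivization.mk ℂ v hv = affinePoint fun i => v i.succ / v 0 := by
  refine (Projectivization.mk_eq_mk_iff' ℂ _ _ _ _).2 ⟨v 0, ?_⟩
  funext i
  refine Fin.cases ?_ (fun i => ?_) i
  · simp
  · simp [mul_div_cancel₀ _ h0]

theorem affinePoint_affineCoord {n : ℕ} {P : Projectivization ℂ (Fin (n + 1) → ℂ)}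
    (h0 : P.rep 0 ≠ 0) : affinePoint (affineCoord P) = P := by
  conv_rhs => rw [← P.mk_rep, mk_eq_affinePoint _ h0]
  rfl

theorem affinePoint_injective {n : ℕ} : Function.Injective (affinePoint (n := n)) := by
  intro u u' h
  obtain ⟨c, hc⟩ := (Projectivization.mk_eq_mk_iff' ℂ _ _ _ _).1 h
  have h1 : c = 1 := by simpa using congrFun hc 0
  funext i
  simpa [h1] using (congrFun hc i.succ).symm

theorem affineCoord_affinePoint {n : ℕ} (u : Fin n → ℂ) :
    affineCoord (affinePoint u) = u := by
  refine affinePoint_injective (affinePoint_affineCoord ?_)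
  obtain ⟨c, hc⟩ := Projectivization.exists_smul_eq_mk_rep ℂ _ (cons_one_ne_zero u)
  have := congrFun hc 0
  simp [Units.smul_def] at this
  rw [affinePoint, ← this]
  exact c.ne_zero

noncomputable instance fintypeRootsOfUnity (k : ℕ) : Fintype (rootsOfUnity (k + 1) ℂ) :=
  Fintype.ofFinite _

theorem fintypeCard_rootsOfUnity (k : ℕ) : Fintype.card (rootsOfUnity (k + 1) ℂ) = k + 1 := by
  rw [← Nat.card_eq_fintype_card, Complex.card_rootsOfUnity]

/-- The points `[1 : u₁ ζ₁ : ⋯ : uₙ ζₙ]` with all `ζᵢ` running over the `(k + 1)`-st roots of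
unity. -/
noncomputable def rootOrbit {n : ℕ} (k : ℕ) (u : Fin n → ℂ) :
    Finset (Projectivization ℂ (Fin (n + 1) → ℂ)) := by
  classical exact Finset.univ.image fun ζ : Fin n → rootsOfUnity (k + 1) ℂ =>
    affinePoint fun i => u i * ((ζ i : ℂˣ) : ℂ)

theorem mem_rootOrbit {n k : ℕ} {u : Fin n → ℂ} {P : Projectivization ℂ (Fin (n + 1) → ℂ)} :
    P ∈ rootOrbit k u ↔
      ∃ ζ : Fin n → rootsOfUnity (k + 1) ℂ, affinePoint (fun i => u i * ((ζ i : ℂˣ) : ℂ)) = P := by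
  simp [rootOrbit]

theorem rootOrbit_param_injective {n : ℕ} (k : ℕ) {u : Fin n → ℂ} (hu : ∀ i, u i ≠ 0) :
    Function.Injective fun ζ : Fin n → rootsOfUnity (k + 1) ℂ =>
      affinePoint fun i => u i * ((ζ i : ℂˣ) : ℂ) := by
  intro ζ ζ' h
  funext i
  have := congrFun (affinePoint_injective h) i
  exact Subtype.ext (Units.ext (mul_left_cancel₀ (hu i) this))

theorem card_rootOrbit {n : ℕ} (k : ℕ) {u : Fin n → ℂ} (hu : ∀ i, u i ≠ 0) :
    (rootOrbit k u).card = (k + 1) ^ n := by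
  classical
  rw [rootOrbit, Finset.card_image_of_injective _ (rootOrbit_param_injective k hu),
    Finset.card_univ, Fintype.card_fun, fintypeCard_rootsOfUnity, Fintype.card_fin]

theorem affinePoint_mem_rootOrbit {n : ℕ} {k : ℕ} {u v : Fin n → ℂ} (hu : ∀ i, u i ≠ 0)
    (h : ∀ i, v i ^ (k + 1) = u i ^ (k + 1)) : affinePoint v ∈ rootOrbit k u := by
  have hr : ∀ i, (v i / u i) ^ (k + 1) = 1 := fun i => by
    rw [div_pow, h, div_self (pow_ne_zero _ (hu i))]
  refine mem_rootOrbit.2 ⟨fun i => rootsOfUnity.mkOfPowEq _ (hr i), ?_⟩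
  congr 1
  funext i
  simp [mul_div_cancel₀ _ (hu i)]

theorem affinePoint_self_mem_rootOrbit {n : ℕ} (k : ℕ) {u : Fin n → ℂ} (hu : ∀ i, u i ≠ 0) :
    affinePoint u ∈ rootOrbit k u :=
  affinePoint_mem_rootOrbit hu fun _ => rfl

theorem sum_rootsOfUnity_pow (k m : ℕ) :
    ∑ ζ : rootsOfUnity (k + 1) ℂ, (((ζ : ℂˣ) : ℂ)) ^ m =
      if k + 1 ∣ m then (k + 1 : ℂ) else 0 := by
  obtain ⟨ω, hω⟩ : ∃ ω : rootsOfUnity (k + 1) ℂ, IsPrimitiveRoot ((ω : ℂˣ) : ℂ) (k + 1) :=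
    ⟨(Complex.isPrimitiveRoot_exp (k + 1) k.succ_ne_zero).toRootsOfUnity, by
      simpa using Complex.isPrimitiveRoot_exp (k + 1) k.succ_ne_zero⟩
  split_ifs with hdvd
  · obtain ⟨q, rfl⟩ := hdvd
    rw [Finset.sum_congr rfl (g := fun _ => (1 : ℂ))]
    · simp [fintypeCard_rootsOfUnity]
    · intro ζ _
      have := (mem_rootsOfUnity' _ _).1 ζ.2
      rw [pow_mul, this, one_pow]
  · have hne : (((ω : ℂˣ) : ℂ)) ^ m ≠ 1 := fun h => hdvd ((hω.pow_eq_one_iff_dvd m).1 h)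
    have h : (((ω : ℂˣ) : ℂ)) ^ m * ∑ ζ : rootsOfUnity (k + 1) ℂ, (((ζ : ℂˣ) : ℂ)) ^ m =
        ∑ ζ : rootsOfUnity (k + 1) ℂ, (((ζ : ℂˣ) : ℂ)) ^ m := by
      rw [Finset.mul_sum, ← Equiv.sum_comp (Equiv.mulLeft ω)
        fun ζ : rootsOfUnity (k + 1) ℂ => (((ζ : ℂˣ) : ℂ)) ^ m]
      simp [mul_pow]
    have h2 := sub_eq_zero.2 h
    rw [← sub_one_mul] at h2
    exact (mul_eq_zero.1 h2).resolve_left (sub_ne_zero.2 hne)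

/-! ### Decompositions of the monomial -/

/-- The affine moments of a decomposition of `(x₀ ⋯ xₙ) ^ k`, over its points with `x₀ ≠ 0`. In
degree `(n + 1) k` itself there must be no other points. -/
theorem affine_moments {n k : ℕ} {T : Finset (Projectivization ℂ (Fin (n + 1) → ℂ))}
    {w : Projectivization ℂ (Fin (n + 1) → ℂ) → ℂ}
    (hw : (∏ i, X i : MvPolynomial (Fin (n + 1)) ℂ) ^ k =
      ∑ P ∈ T, w P • linearForm P.rep ^ ((n + 1) * k)) (γ : Fin n → ℕ)
    (hle : ∑ i, γ i ≤ (n + 1) * k)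
    (hγ : ∀ P ∈ T, P.rep 0 = 0 → ∑ i, γ i < (n + 1) * k) :
    ∑ P : {P // P ∈ T.filter fun P => P.rep 0 ≠ 0},
        (w P.1 * P.1.rep 0 ^ ((n + 1) * k)) * ∏ i, affineCoord P.1 i ^ γ i =
      if γ = fun _ => k
        then (Nat.multinomial (Finset.univ : Finset (Fin (n + 1))) fun _ => k : ℂ)⁻¹ else 0 := by
  -- Homogenize: `x₀` receives the missing degree, so a point with `x₀ = 0` contributes nothing as
  -- long as that degree is positive.
  have h := (prod_X_pow_eq_sum_iff k T w _).1 hw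
    (Fin.cons ((n + 1) * k - ∑ i, γ i) γ) (by rw [Fin.sum_univ_succ]; simp; omega)
  have hiff : (Fin.cons ((n + 1) * k - ∑ i, γ i) γ : Fin (n + 1) → ℕ) = (fun _ => k) ↔
      γ = fun _ => k := by
    constructor
    · intro he
      funext i
      simpa using congrFun he i.succ
    · rintro rfl
      funext i
      refine Fin.cases ?_ (fun i => ?_) i
      · simp [add_mul]
      · simp
  simp only [hiff] at h
  rw [← h, Finset.sum_coe_sort (T.filter fun P => P.rep 0 ≠ 0)
    (fun P => (w P * P.rep 0 ^ ((n + 1) * k)) * ∏ i, affineCoord P i ^ γ i), Finset.sum_filter]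
  refine Finset.sum_congr rfl fun P hP => ?_
  rw [Fin.prod_univ_succ]
  simp only [Fin.cons_zero, Fin.cons_succ]
  split_ifs with h0
  · simp only [affineCoord, div_pow, Finset.prod_div_distrib, Finset.prod_pow_eq_pow_sum]
    have : P.rep 0 ^ ((n + 1) * k) =
        P.rep 0 ^ ((n + 1) * k - ∑ i, γ i) * P.rep 0 ^ ∑ i, γ i := by
      rw [← pow_add, Nat.sub_add_cancel hle]
    rw [this]
    field_simp
  · rw [not_not] at h0
    have := hγ P hP h0
    rw [h0, zero_pow (by omega), zero_mul, mul_zero]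

/-- Since `n k < d`, points with `x₀ = 0` do not affect the moments used. In the case of equality
there are therefore none, which makes the moments of degree `d` available too. -/
theorem card_filter_ge {n k : ℕ} (hk : 1 ≤ k)
    {T : Finset (Projectivization ℂ (Fin (n + 1) → ℂ))}
    (hT : (∏ i, X i : MvPolynomial (Fin (n + 1)) ℂ) ^ k ∈ veroneseSpan ((n + 1) * k) T) :
    (k + 1) ^ n ≤ (T.filter fun P => P.rep 0 ≠ 0).card := by
  obtain ⟨w, hw⟩ := mem_veroneseSpan_iff.1 hT
  have hlt : n * k < (n + 1) * k := by rw [add_mul]; omega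
  have := card_ge_of_moments (k := k) (inv_ne_zero (multinomial_ne_zero _)) fun γ hγ =>
    affine_moments hw γ (hγ.trans hlt.le) fun _ _ _ => hγ.trans_lt hlt
  rwa [Fintype.card_coe] at this

/-- A decomposition of `(x₀ ⋯ xₙ) ^ k` has at least `(k + 1) ^ n` points. -/
theorem card_ge_of_prod_X_pow_mem {n k : ℕ} (hk : 1 ≤ k)
    {T : Finset (Projectivization ℂ (Fin (n + 1) → ℂ))}
    (hT : (∏ i, X i : MvPolynomial (Fin (n + 1)) ℂ) ^ k ∈ veroneseSpan ((n + 1) * k) T) :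
    (k + 1) ^ n ≤ T.card :=
  (card_filter_ge hk hT).trans (Finset.card_filter_le _ _)

/-- A decomposition of `(x₀ ⋯ xₙ) ^ k` with `(k + 1) ^ n` points is determined by any of its
points with nonzero coordinates. -/
theorem eq_rootOrbit {n k : ℕ} (hk : 1 ≤ k)
    {T : Finset (Projectivization ℂ (Fin (n + 1) → ℂ))}
    (hT : (∏ i, X i : MvPolynomial (Fin (n + 1)) ℂ) ^ k ∈ veroneseSpan ((n + 1) * k) T)
    (hcard : T.card ≤ (k + 1) ^ n) {u : Fin n → ℂ} (hu : ∀ i, u i ≠ 0)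
    (hmem : affinePoint u ∈ T) : T = rootOrbit k u := by
  set T' := T.filter fun P => P.rep 0 ≠ 0 with hT'
  have hge : (k + 1) ^ n ≤ T'.card := card_filter_ge hk hT
  have hfilter : T' = T :=
    Finset.eq_of_subset_of_card_le (Finset.filter_subset _ _) (hcard.trans hge)
  have h0 : ∀ P ∈ T, P.rep 0 ≠ 0 := Finset.filter_eq_self.1 hfilter
  have hcard' : Fintype.card T' = (k + 1) ^ n := by
    rw [Fintype.card_coe]
    exact le_antisymm (hfilter.symm ▸ hcard) hge
  obtain ⟨w, hw⟩ := mem_veroneseSpan_iff.1 hT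
  have key := pow_eq_of_moments (k := k) (ι := T')
    (u := fun P => affineCoord P.1) (w := fun P => w P.1 * P.1.rep 0 ^ ((n + 1) * k))
    (inv_ne_zero (multinomial_ne_zero fun _ => k))
    (fun γ hγ => affine_moments hw γ hγ fun P hP h => absurd h (h0 P hP)) hcard'
  refine Finset.eq_of_subset_of_card_le (fun P hP => ?_) ?_
  · rw [← affinePoint_affineCoord (h0 P hP)]
    refine affinePoint_mem_rootOrbit hu fun i => ?_
    have := key i ⟨P, hfilter.symm ▸ hP⟩ ⟨affinePoint u, hfilter.symm ▸ hmem⟩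
    simpa only [affineCoord_affinePoint] using this
  · rw [card_rootOrbit k hu]
    exact card_ge_of_prod_X_pow_mem hk hT

/-- A nonzero product forces `γ i ≡ k` modulo `k + 1` for all `i`; any `γ i ≠ k` would then push the
degree to at least `n k + k + 1`. -/
theorem prod_sum_rootsOfUnity_pow {n k : ℕ} (γ : Fin n → ℕ) (hγ : ∑ i, γ i ≤ (n + 1) * k) :
    ∏ i, ∑ ζ : rootsOfUnity (k + 1) ℂ, (((ζ : ℂˣ) : ℂ)) ^ (γ i + 1) =
      if γ = fun _ => k then (k + 1 : ℂ) ^ n else 0 := by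
  simp only [sum_rootsOfUnity_pow]
  split_ifs with h
  · subst h
    simp
  · by_contra hne
    have hdvd : ∀ i, k + 1 ∣ γ i + 1 := fun i => by
      by_contra hi
      exact hne (Finset.prod_eq_zero (Finset.mem_univ i) (if_neg hi))
    have hge : ∀ i, k ≤ γ i := fun i => by
      have := Nat.le_of_dvd (Nat.succ_pos _) (hdvd i)
      omega
    obtain ⟨j, hj⟩ := Function.ne_iff.1 h
    have hj' : k + (k + 1) ≤ γ j := by
      obtain ⟨q, hq⟩ := hdvd j
      have hq2 : 2 ≤ q := by
        by_contra hlt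
        interval_cases q
        · omega
        · exact hj (by omega)
      have := Nat.mul_le_mul_left (k + 1) hq2
      omega
    have hsum : ∑ i, (k + if i = j then k + 1 else 0) ≤ ∑ i, γ i := by
      refine Finset.sum_le_sum fun i _ => ?_
      split_ifs with hi
      · rwa [hi]
      · exact hge i
    rw [Finset.sum_add_distrib, Finset.sum_ite_eq', if_pos (Finset.mem_univ _)] at hsum
    simp only [Finset.sum_const, Finset.card_univ, Fintype.card_fin, smul_eq_mul] at hsum
    rw [add_mul] at hγ
    omega

/-- With weights proportional to `∏ ζᵢ`, each moment factors into power sums of roots of unity with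
exponents `γ i + 1`. -/
theorem prod_X_pow_eq_sum_rootOrbit {n k : ℕ} {u : Fin n → ℂ} (hu : ∀ i, u i ≠ 0) :
    ∃ μ : ℂ, μ ≠ 0 ∧ (∏ i, X i : MvPolynomial (Fin (n + 1)) ℂ) ^ k =
      ∑ ζ : Fin n → rootsOfUnity (k + 1) ℂ, (μ * ∏ i, ((ζ i : ℂˣ) : ℂ)) •
        linearForm (Fin.cons 1 fun i => u i * ((ζ i : ℂˣ) : ℂ)) ^ ((n + 1) * k) := by
  set κ : ℂ := (Nat.multinomial (Finset.univ : Finset (Fin (n + 1))) fun _ => k : ℂ)⁻¹ with hκ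
  have hκ0 : κ ≠ 0 := inv_ne_zero (multinomial_ne_zero _)
  have hk0 : (k + 1 : ℂ) ^ n ≠ 0 := pow_ne_zero _ (Nat.cast_add_one_ne_zero k)
  have hu0 : ∏ i, u i ^ k ≠ 0 := Finset.prod_ne_zero_iff.2 fun i _ => pow_ne_zero _ (hu i)
  refine ⟨κ * ((k + 1 : ℂ) ^ n)⁻¹ * (∏ i, u i ^ k)⁻¹,
    mul_ne_zero (mul_ne_zero hκ0 (inv_ne_zero hk0)) (inv_ne_zero hu0), ?_⟩
  rw [prod_X_pow_eq_sum_iff]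
  intro γ hγ
  have hsucc : γ 0 + ∑ i : Fin n, γ i.succ = (n + 1) * k := by rw [← hγ, Fin.sum_univ_succ]
  have hiff : γ = (fun _ => k) ↔ (fun i : Fin n => γ i.succ) = fun _ => k := by
    constructor
    · rintro rfl
      rfl
    · intro h
      have h1 : ∀ i : Fin n, γ i.succ = k := fun i => congrFun h i
      funext i
      refine Fin.cases ?_ h1 i
      simp only [h1, Finset.sum_const, Finset.card_univ, Fintype.card_fin, smul_eq_mul] at hsucc
      rw [add_mul] at hsucc
      omega
  have hterm : ∀ ζ : Fin n → rootsOfUnity (k + 1) ℂ,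
      (κ * ((k + 1 : ℂ) ^ n)⁻¹ * (∏ i, u i ^ k)⁻¹ * ∏ i, ((ζ i : ℂˣ) : ℂ)) *
        ∏ i, (Fin.cons 1 fun i => u i * ((ζ i : ℂˣ) : ℂ) : Fin (n + 1) → ℂ) i ^ γ i =
      (κ * ((k + 1 : ℂ) ^ n)⁻¹ * (∏ i, u i ^ k)⁻¹ * ∏ i, u i ^ γ i.succ) *
        ∏ i, ((ζ i : ℂˣ) : ℂ) ^ (γ i.succ + 1) := by
    intro ζ
    rw [Fin.prod_univ_succ]
    simp only [Fin.cons_zero, Fin.cons_succ, one_pow, one_mul, mul_pow, Finset.prod_mul_distrib,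
      pow_succ]
    ring
  rw [Finset.sum_congr rfl fun ζ _ => hterm ζ, ← Finset.mul_sum,
    ← Fintype.prod_sum (fun (i : Fin n) (ζ : rootsOfUnity (k + 1) ℂ) =>
       ((ζ : ℂˣ) : ℂ) ^ (γ i.succ + 1)),
    prod_sum_rootsOfUnity_pow (fun i => γ i.succ) (by omega)]
  simp only [hiff]
  split_ifs with h
  · have h1 : ∏ i, u i ^ γ i.succ = ∏ i, u i ^ k :=
      Finset.prod_congr rfl fun i _ => by rw [show γ i.succ = k from congrFun h i]
    rw [h1, ← hκ]
    field_simp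
  · rw [mul_zero]

/-- Subtracting a suitable nonzero multiple of `ℓ ^ ((n + 1) k)` from `(x₀ ⋯ xₙ) ^ k` removes
`[ℓ]` from the decomposition through it. -/
theorem exists_sub_mem_veroneseSpan_erase {n : ℕ} [DecidableEq (Projectivization ℂ (Fin (n + 1) → ℂ))]
    {k : ℕ} {u : Fin n → ℂ} (hu : ∀ i, u i ≠ 0) :
    ∃ μ : ℂ, μ ≠ 0 ∧ (∏ i, X i : MvPolynomial (Fin (n + 1)) ℂ) ^ k -
      μ • linearForm (Fin.cons 1 u) ^ ((n + 1) * k) ∈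
        veroneseSpan ((n + 1) * k) ((rootOrbit k u).erase (affinePoint u)) := by
  classical
  obtain ⟨μ, hμ, h⟩ := prod_X_pow_eq_sum_rootOrbit (k := k) hu
  refine ⟨μ, hμ, ?_⟩
  rw [h, ← Finset.add_sum_erase _ _ (Finset.mem_univ 1)]
  simp only [Pi.one_apply, OneMemClass.coe_one, Units.val_one, Finset.prod_const_one, mul_one,
    add_sub_cancel_left]
  refine Submodule.sum_mem _ fun ζ hζ => Submodule.smul_mem _ _ ?_
  refine linearForm_pow_mem_veroneseSpan (cons_one_ne_zero _) (Finset.mem_erase.2 ⟨?_, ?_⟩)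
  · intro he
    apply Finset.ne_of_mem_erase hζ
    apply rootOrbit_param_injective k hu
    simpa [affinePoint] using he
  · exact mem_rootOrbit.2 ⟨ζ, rfl⟩

theorem exists_monomialPlusPower_mem_veroneseSpan_erase
    {n : ℕ} [DecidableEq (Projectivization ℂ (Fin (n + 1) → ℂ))] {k : ℕ} {a : Fin (n + 1) → ℂ}
    (ha : ∀ i, a i ≠ 0) :
    ∃ c : ℂ, c ≠ 0 ∧ monomialPlusPower k a c ∈ veroneseSpan ((n + 1) * k)
      ((rootOrbit k fun i => a i.succ / a 0).erase (affinePoint fun i => a i.succ / a 0)) := by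
  obtain ⟨μ, hμ, h⟩ := exists_sub_mem_veroneseSpan_erase (k := k)
    (u := fun i => a i.succ / a 0) fun i => div_ne_zero (ha _) (ha _)
  have hcons : (Fin.cons 1 fun i => a i.succ / a 0 : Fin (n + 1) → ℂ) = (a 0)⁻¹ • a := by
    funext i
    refine Fin.cases ?_ (fun i => ?_) i
    · simp [ha 0]
    · simp [div_eq_inv_mul]
  -- The sign turns the subtraction into an addition; the power of `(a 0)⁻¹` comes from normalizing
  -- `ℓ` to have `x₀`-coefficient 1.
  refine ⟨-(μ * (a 0)⁻¹ ^ ((n + 1) * k)),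
    neg_ne_zero.2 (mul_ne_zero hμ (pow_ne_zero _ (inv_ne_zero (ha 0)))), ?_⟩
  rw [hcons, linearForm_smul_pow, smul_smul] at h
  rwa [monomialPlusPower, C_mul', neg_smul, ← sub_eq_add_neg]

end Waring

/-! ### Rank of the monomial plus a power -/

open Waring in
theorem proposition3p1 (n k : ℕ) (hn : 1 ≤ n) (hk : 1 ≤ k)
    (a : Fin (n + 1) → ℂ) (ha : ∀ i, a i ≠ 0) :
    ∃! c₀ : ℂ, c₀ ≠ 0 ∧ ∀ c : ℂ, c ≠ 0 →
      (Waring.waringRank ((n + 1) * k) (Waring.monomialPlusPower k a c) = (k + 1) ^ n - 1 ↔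
        c = c₀) ∧
      (c = c₀ → ∃! S : Finset (Projectivization ℂ (Fin (n + 1) → ℂ)),
        Waring.IsMinimalDecomposition ((n + 1) * k) (Waring.monomialPlusPower k a c) S) ∧
      (c ≠ c₀ →
        Waring.waringRank ((n + 1) * k) (Waring.monomialPlusPower k a c) = (k + 1) ^ n) := by
  classical
  have hd : (n + 1) * k ≠ 0 := Nat.mul_ne_zero n.succ_ne_zero (by omega)
  have hN : 1 ≤ (k + 1) ^ n := Nat.one_le_pow _ _ k.succ_pos
  set u : Fin n → ℂ := fun i => a i.succ / a 0 with hu_def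
  have hu : ∀ i, u i ≠ 0 := fun i => div_ne_zero (ha _) (ha _)
  have ha0 : a ≠ 0 := fun h => ha 0 (congrFun h 0)
  have hmk : Projectivization.mk ℂ a ha0 = affinePoint u := mk_eq_affinePoint ha0 (ha 0)
  set Z := (rootOrbit k u).erase (affinePoint u) with hZ
  have hpZ : affinePoint u ∈ rootOrbit k u := affinePoint_self_mem_rootOrbit k hu
  have hZcard : Z.card = (k + 1) ^ n - 1 := by
    rw [hZ, Finset.card_erase_of_mem hpZ, card_rootOrbit k hu]
  obtain ⟨c₀, hc₀, hmem⟩ := exists_monomialPlusPower_mem_veroneseSpan_erase (k := k) ha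
  have hpow : ∀ {S}, affinePoint u ∈ S →
      linearForm a ^ ((n + 1) * k) ∈ veroneseSpan ((n + 1) * k) S := fun h =>
    linearForm_pow_mem_veroneseSpan ha0 (by rwa [hmk])
  have hsub : ∀ c c', monomialPlusPower k a c' =
      monomialPlusPower k a c + (c' - c) • linearForm a ^ ((n + 1) * k) := by
    intro c c'
    simp only [monomialPlusPower, MvPolynomial.C_mul', sub_smul]
    abel
  have hzero : monomialPlusPower k a 0 = (∏ i, MvPolynomial.X i) ^ k := by
    simp [monomialPlusPower]
  have hins : ∀ {c S}, monomialPlusPower k a c ∈ veroneseSpan ((n + 1) * k) S →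
      (∏ i, MvPolynomial.X i) ^ k ∈
        veroneseSpan ((n + 1) * k) (insert (affinePoint u) S) := by
    intro c S h
    rw [← hzero, hsub c 0]
    exact Submodule.add_mem _ (veroneseSpan_mono (Finset.subset_insert _ _) h)
      (Submodule.smul_mem _ _ (hpow (Finset.mem_insert_self _ _)))
  have hge : ∀ {c S}, monomialPlusPower k a c ∈ veroneseSpan ((n + 1) * k) S →
      (k + 1) ^ n - 1 ≤ S.card := by
    intro c S h
    have := (card_ge_of_prod_X_pow_mem hk (hins h)).trans (Finset.card_insert_le _ _)
    omega
  have hsmall : ∀ {c S}, monomialPlusPower k a c ∈ veroneseSpan ((n + 1) * k) S →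
      S.card ≤ (k + 1) ^ n - 1 → S = Z ∧ c = c₀ := by
    intro c S h hS
    have hle : (insert (affinePoint u) S).card ≤ (k + 1) ^ n :=
      (Finset.card_insert_le _ _).trans (by omega)
    have heq := eq_rootOrbit hk (hins h) hle hu (Finset.mem_insert_self _ _)
    -- Otherwise `S` alone would decompose the monomial with fewer than `N` points.
    have hnot : affinePoint u ∉ S := by
      intro hin
      have := card_ge_of_prod_X_pow_mem hk (hins h)
      rw [Finset.insert_eq_of_mem hin] at this
      omega
    have hSZ : S = Z := by rw [hZ, ← heq, Finset.erase_insert hnot]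
    refine ⟨hSZ, ?_⟩
    -- Two values of `c` on `Z` would put `ℓ ^ d`, hence the monomial, in the span of its `N - 1`
    -- points.
    by_contra hne
    rw [hSZ, hsub c₀ c, Submodule.add_mem_iff_right _ hmem,
      Submodule.smul_mem_iff _ (sub_ne_zero.2 hne)] at h
    have hm : (∏ i, MvPolynomial.X i) ^ k ∈ veroneseSpan ((n + 1) * k) Z := by
      rw [← hzero, hsub c₀ 0]
      exact Submodule.add_mem _ hmem (Submodule.smul_mem _ _ h)
    have := card_ge_of_prod_X_pow_mem hk hm
    omega
  have hfull : ∀ c, monomialPlusPower k a c ∈ veroneseSpan ((n + 1) * k) (rootOrbit k u) := by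
    intro c
    rw [hsub c₀ c]
    exact Submodule.add_mem _ (veroneseSpan_mono (Finset.erase_subset _ _) hmem)
      (Submodule.smul_mem _ _ (hpow hpZ))
  -- `hfull` ensures that the infimum defining the rank is attained and is not the default value 0.
  have hrank_ge : ∀ c, (k + 1) ^ n - 1 ≤
      waringRank ((n + 1) * k) (monomialPlusPower k a c) := by
    intro c
    obtain ⟨T, hT, hTm⟩ := exists_card_le_waringRank hd (hfull c)
    exact (hge hTm).trans hT
  have hrank₀ : waringRank ((n + 1) * k) (monomialPlusPower k a c₀) = (k + 1) ^ n - 1 :=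
    le_antisymm (hZcard ▸ waringRank_le_card hd hmem) (hrank_ge c₀)
  have hrank_iff : ∀ c, waringRank ((n + 1) * k) (monomialPlusPower k a c) = (k + 1) ^ n - 1 ↔
      c = c₀ := by
    refine fun c => ⟨fun h => ?_, fun h => h ▸ hrank₀⟩
    obtain ⟨T, hT, hTm⟩ := exists_card_le_waringRank hd (hfull c)
    exact (hsmall hTm (hT.trans h.le)).2
  refine ⟨c₀, ⟨hc₀, fun c _ => ⟨hrank_iff c, ?_, ?_⟩⟩, ?_⟩
  · rintro rfl
    refine ⟨Z, ⟨hmem, hZcard.trans hrank₀.symm⟩, ?_⟩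
    rintro S ⟨hS, hScard⟩
    exact (hsmall hS (hScard.trans hrank₀).le).1
  · intro hc
    have h1 := waringRank_le_card hd (hfull c)
    rw [card_rootOrbit k hu] at h1
    have h2 := hrank_ge c
    have h3 := mt (hrank_iff c).1 hc
    omega
  · rintro c₁ ⟨hc₁, h⟩
    exact (hrank_iff c₁).1 ((h c₁ hc₁).1.2 rfl)
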